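/- **Setting.** A dense feed-forward network with $L\ge 1$ layers maps $z_0=x\in\mathbb R^{n_1}$ to $N(x)=z_L(x)$ by $z_\ell=\varphi_\ell(W_\ell z_{\ell-1}+b_\ell)$, with $W_\ell\in\mathbb R^{m_\ell\times n_\ell}$, $b_\ell\in\mathbb R^{m_\ell}$, $n_{\ell+1}=m_\ell$, $m_L\ge 1$. Each $\varphi_\ell$ acts entrywise, $\varphi_\ell(0)=0$, $\varphi_\ell$ is Lipschitz with constant $L(\varphi_\ell)$, and $\varphi_L=\mathrm{id}$. A binary floating-point format has precision $p\ge2$, largest exponent $e_{\max}\ge p$, smallest normal exponent $e_{\min}=1-e_{\max}$, gradual underflow, and round-to-nearest, ties-to-even. Put $F_{\max}=(2-2^{1-p})2^{e_{\max}}$, $u=2^{-p}$, $a_{\mathrm{mul}}=2^{e_{\min}-p}$, $\gamma_n=(1+u)^n-1$, $\kappa_n=\gamma_n+u(1+\gamma_n)$, $a_{\mathrm{dot}}(n)=(1+\gamma_n)\,n\,a_{\mathrm{mul}}$ and $a_{\mathrm{dot}}^{\mathrm{fwd}}(n)=(1+\gamma_{n-1})\,n\,a_{\mathrm{mul}}$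 (which is $0$ for $n=0$). An operation overflows if its rounded result exceeds $F_{\max}$ in magnitude. The floating-point execution is $\hat z_0=x$, $\hat z_\ell=\varphi_\ell(\mathrm{fl}(\mathrm{fl}(W_\ell\hat z_{\ell-1})+b_\ell))$, where each product and each addition of a dot product is rounded and the dot product of each row is summed in an arbitrary fixed order; $\hat N(x)=\hat z_L(x)$. Let a target format and a high-precision format be given, the latter with precision and largest exponent at least those of the former; a superscript $\mathrm{hi}$ marks quantities of the latter. The activations are exact in both formats: they map finite floating-point values to finite floating-point values and are evaluated on them without rounding. For $\varepsilon\ge 0$ let $$r_0=\|x\|_2+\varepsilon,\quad r_\ell=L(\varphi_\ell)(\|W_\ell\|_2r_{\ell-1}+\|b_\ell\|_2),\qquad D_0=0,\quad D_\ell=\alpha_\ell D_{\ell-1}+\beta_\ell(r_{\ell-1}),$$ $$\alpha_\ell=L(\varphi_\ell)\bigl(\|W_\ell\|_2+\kappa_{n_\ell}\||W_\ell|\|_2\bigr),\quad \beta_\ell(r)=L(\varphi_\ell)\bigl(\kappa_{n_\ell}\||W_\ell|\|_2\,r+u\|b_\ell\|_2+(1+u)\,a_{\mathrm{dot}}(n_\ell)\sqrt{m_\ell}\bigr),$$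 written $r_\ell(x,\varepsilon)$, $D_\ell(x,\varepsilon)$. For output classes $i\neq j$, with rows $W_{L,i},W_{L,j}$ of $W_L$, let $$\alpha_L^{(j,i)}=\|W_{L,i}-W_{L,j}\|_2+\kappa_{n_L}\||W_{L,i}|+|W_{L,j}|\|_2,$$ $$\beta_L^{(j,i)}(r)=\kappa_{n_L}\||W_{L,i}|+|W_{L,j}|\|_2\,r+u(|b_{L,i}|+|b_{L,j}|)+2(1+u)\,a_{\mathrm{dot}}(n_L),$$ $m_{j,i}=N_i-N_j$, $\hat m_{j,i}=\hat N_i-\hat N_j$, and $$E_{\mathrm{ball}}^{(j,i)}=\alpha_L^{(j,i)}D_{L-1}(x,\varepsilon)+\beta_L^{(j,i)}(r_{L-1}(x,\varepsilon)),$$ $$D^{\mathrm{hybrid}}_{L-1}(x)=\|\hat z_{L-1}(x)-\hat z_{L-1}^{\mathrm{hi}}(x)\|_2+D_{L-1}^{\mathrm{hi}}(x,0),$$ $$E_{\mathrm{ctr}}^{\mathrm{hybrid},(j,i)}=\alpha_L^{(j,i)}D^{\mathrm{hybrid}}_{L-1}(x)+\beta_L^{(j,i)}(r_{L-1}(x,0)).$$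 **Theorem (hybrid pre-deployment certification).** Let $x\in\mathbb R^{n_1}$, $\varepsilon>0$ and $i^*=\mathrm{ArgMax}(N(x))$ (the first index of a maximal component). Suppose: 1. for every layer $\ell$, the entries of $W_\ell$ and $b_\ell$ are finite values of the target format, and, with $w_{\ell,i}$ the rows of $W_\ell$, $R=r_{\ell-1}(x,\varepsilon)+D_{\ell-1}(x,\varepsilon)$, $S_\ell=\max_i\|w_{\ell,i}\|_2R$ and $M_\ell=\max_i\|w_{\ell,i}\|_\infty R$, $$S_\ell(1+\gamma_{n_\ell})+a_{\mathrm{dot}}^{\mathrm{fwd}}(n_\ell)+\|b_\ell\|_\infty<F_{\max},\qquad M_\ell<F_{\max};$$ 2. for every $j\ne i^*$, $L_{j,i^*}\ge0$ satisfies $|m_{j,i^*}(x_1)-m_{j,i^*}(x_2)|\le L_{j,i^*}\|x_1-x_2\|_2$ for all $x_1,x_2\in\mathbb R^{n_1}$; 3. for every $j\neq i^*$, $\ \hat m_{j,i^*}(x)-L_{j,i^*}\varepsilon-\bigl(E_{\mathrm{ctr}}^{\mathrm{hybrid},(j,i^*)}+E_{\mathrm{ball}}^{(j,i^*)}\bigr)>0$.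 Then for every $x'\in\mathbb R^{n_1}$ with $\|x-x'\|_2\le\varepsilon$ the floating-point execution at $x'$ in the target format does not overflow, $\hat m_{j,i^*}(x')>0$ for every $j\ne i^*$, and $\mathrm{ArgMax}(\hat N(x'))=i^*$. In particular $\mathrm{ArgMax}(\hat N(x'))=\mathrm{ArgMax}(\hat N(x))$, that is, $x$ is robust for $\varepsilon$ under floating-point execution. -/

import Mathlib

open scoped NNReal

noncomputable section

namespace FPCert

/-! ### Binary floating-point formats, round-to-nearest-even with gradual underflow -/

/-- A binary interchange-style format: `prec` significand bits (the hidden bit included) and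
largest exponent `emax`. For example float32 is `(24, 127)` and float64 is `(53, 1023)`. -/
structure FloatFormat where
  prec : ℕ
  emax : ℕ
  two_le_prec : 2 ≤ prec
  prec_le_emax : prec ≤ emax

/-- Nearest integer, ties going to the even neighbour. -/
def roundEven (t : ℝ) : ℤ :=
  if Int.fract t < 1 / 2 then ⌊t⌋
  else if 1 / 2 < Int.fract t then ⌊t⌋ + 1
  else if Even ⌊t⌋ then ⌊t⌋ else ⌊t⌋ + 1

namespace FloatFormat

variable (F : FloatFormat)

/-- Smallest exponent of a normal number. -/
def emin : ℤ := 1 - (F.emax : ℤ)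

/-- The largest finite value `(2 - 2^(1-prec)) * 2^emax`. -/
def maxFinite : ℝ := (2 - (2 : ℝ) ^ (1 - (F.prec : ℤ))) * (2 : ℝ) ^ F.emax

/-- Values `m * 2^e` with at most `prec` significant bits, subnormal numbers included, with no
upper limit on the exponent. -/
def IsFloat (v : ℝ) : Prop :=
  ∃ m e : ℤ, |m| < 2 ^ F.prec ∧ F.emin - (F.prec : ℤ) + 1 ≤ e ∧ v = (m : ℝ) * (2 : ℝ) ^ e

/-- The finite values of the format. -/
def IsFinite (v : ℝ) : Prop := F.IsFloat v ∧ |v| ≤ F.maxFinite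

/-- Spacing of the format at `x`; below `2^emin` the spacing is constant (gradual underflow). -/
def spacing (x : ℝ) : ℝ := (2 : ℝ) ^ (max (Int.log 2 |x|) F.emin - (F.prec : ℤ) + 1)

/-- Rounding to nearest, ties to even. The exponent is not limited from above, as in the IEEE
definition of overflow: an operation overflows iff its rounded result exceeds `maxFinite` in
magnitude, and otherwise `fl` is the value that the format returns. -/
def fl (x : ℝ) : ℝ := (roundEven (x / F.spacing x) : ℝ) * F.spacing x

/-- Unit roundoff `u`. -/
def unitRoundoff : ℝ := (2 : ℝ) ^ (-(F.prec : ℤ))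

/-- Absolute error bound `a_mul` of a subnormal product: half of the least positive float. -/
def absErr : ℝ := (2 : ℝ) ^ (F.emin - (F.prec : ℤ))

/-- `γ_n = (1 + u)^n - 1`. -/
def gam (n : ℕ) : ℝ := (1 + F.unitRoundoff) ^ n - 1

/-- `κ_n = γ_n + u (1 + γ_n)`. -/
def kap (n : ℕ) : ℝ := F.gam n + F.unitRoundoff * (1 + F.gam n)

/-- `a_dot(n) = (1 + γ_n) n a_mul`. -/
def aDot (n : ℕ) : ℝ := (1 + F.gam n) * n * F.absErr

/-- `a_dot,fwd(n) = (1 + γ_{n-1}) n a_mul` (equal to `0` for `n = 0`). -/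
def aDotFwd (n : ℕ) : ℝ := (1 + F.gam (n - 1)) * n * F.absErr

/-- A scalar activation is exact in the format: it takes finite floating-point values to finite
floating-point values, so that its floating-point evaluation is the real function itself. -/
def ActExact (f : ℝ → ℝ) : Prop := ∀ v, F.IsFinite v → F.IsFinite (f v)

end FloatFormat

/-! ### Floating-point dot products, in any order of summation -/

/-- An order of evaluation of a sum; `zero` is an accumulator initialised to `0`. -/
inductive SumTree (n : ℕ) : Type
  | zero : SumTree n
  | leaf : Fin n → SumTree n
  | node : SumTree n → SumTree n → SumTree n

namespace SumTree

variable {n : ℕ}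

/-- The indices of the summands, from left to right. -/
def leaves : SumTree n → List (Fin n)
  | zero => []
  | leaf i => [i]
  | node s t => s.leaves ++ t.leaves

/-- The floating-point dot product of `a` and `b`: every product and every addition is rounded. -/
def fpDot (F : FloatFormat) (a b : Fin n → ℝ) : SumTree n → ℝ
  | zero => 0
  | leaf i => F.fl (a i * b i)
  | node s t => F.fl (fpDot F a b s + fpDot F a b t)

/-- Every product and every partial sum of the floating-point dot product is finite. -/
def DotFinite (F : FloatFormat) (a b : Fin n → ℝ) : SumTree n → Prop
  | zero => True
  | leaf i => F.IsFinite (F.fl (a i * b i))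
  | node s t => DotFinite F a b s ∧ DotFinite F a b t ∧
      F.IsFinite (F.fl (fpDot F a b s + fpDot F a b t))

end SumTree

/-- An order of summation of `n` terms: each index occurs exactly once. -/
structure SumOrder (n : ℕ) where
  tree : SumTree n
  perm : tree.leaves.Perm (List.finRange n)

/-! ### Classification and robustness -/

/-- The first index at which a vector attains its maximum. -/
def argMax {n : ℕ} [NeZero n] (y : EuclideanSpace ℝ (Fin n)) : Fin n :=
  (Finset.univ.filter fun i => ∀ j, y j ≤ y i).min' (by
    obtain ⟨i, -, hi⟩ := Finset.exists_max_image Finset.univ (fun i => y i)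
      ⟨(0 : Fin n), Finset.mem_univ _⟩
    exact ⟨i, Finset.mem_filter.2 ⟨Finset.mem_univ _, fun j => hi j (Finset.mem_univ _)⟩⟩)

/-- `x` is robust for `ε` under the classifier `N`. -/
def IsRobust {n m : ℕ} [NeZero m]
    (N : EuclideanSpace ℝ (Fin n) → EuclideanSpace ℝ (Fin m))
    (x : EuclideanSpace ℝ (Fin n)) (ε : ℝ) : Prop :=
  ∀ x', ‖x - x'‖ ≤ ε → argMax (N x') = argMax (N x)

/-! ### Matrix norms -/

/-- Spectral norm `‖A‖₂`. -/
def specNorm {m n : ℕ} (A : Matrix (Fin m) (Fin n) ℝ) : ℝ :=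
  ‖LinearMap.toContinuousLinearMap (Matrix.toEuclideanLin A)‖

/-- Spectral norm `‖|A|‖₂` of the matrix of absolute values. -/
def absSpecNorm {m n : ℕ} (A : Matrix (Fin m) (Fin n) ℝ) : ℝ :=
  specNorm (A.map fun a => |a|)

/-! ### Feed-forward networks -/

/-- A dense feed-forward network with `L = hidden + 1` layers. Layers are numbered from `0`: the
data at index `ℓ` are those of the `(ℓ + 1)`-st layer, so `weight hidden` is the output layer.
Entries with index above `hidden` are never used. `actLip ℓ` is a Lipschitz constant of `act ℓ`. -/
structure Network where
  hidden : ℕ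
  dim : ℕ → ℕ
  weight : ∀ ℓ, Matrix (Fin (dim (ℓ + 1))) (Fin (dim ℓ)) ℝ
  bias : ∀ ℓ, EuclideanSpace ℝ (Fin (dim (ℓ + 1)))
  act : ℕ → ℝ → ℝ
  actLip : ℕ → ℝ≥0

namespace Network

variable (net : Network)

/-- Vectors of activations after `ℓ` layers; `ℓ = 0` is the input. -/
abbrev Vec (ℓ : ℕ) : Type := EuclideanSpace ℝ (Fin (net.dim ℓ))

/-- Exact activations `z_ℓ(x)`. -/
def z (x : net.Vec 0) : (ℓ : ℕ) → net.Vec ℓ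
  | 0 => x
  | ℓ + 1 => WithLp.toLp 2 fun i =>
      net.act ℓ ((∑ k, net.weight ℓ i k * z x ℓ k) + net.bias ℓ i)

/-- The network output `N(x)` in real arithmetic. -/
def output (x : net.Vec 0) : net.Vec (net.hidden + 1) := net.z x (net.hidden + 1)

/-- The margin `m_{j,i}(x) = N(x)_i - N(x)_j`. -/
def margin (i j : Fin (net.dim (net.hidden + 1))) (x : net.Vec 0) : ℝ :=
  net.output x i - net.output x j

/-- For each layer and each output row, the order in which the dot product is summed. -/
abbrev Schedule : Type := ∀ ℓ, Fin (net.dim (ℓ + 1)) → SumOrder (net.dim ℓ)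

section FloatingPoint

variable (F : FloatFormat) (σ : net.Schedule)

/-- Floating-point preactivation of the layer with index `ℓ` on the layer input `v`. -/
def fpPreact (ℓ : ℕ) (v : net.Vec ℓ) (i : Fin (net.dim (ℓ + 1))) : ℝ :=
  F.fl ((σ ℓ i).tree.fpDot F (net.weight ℓ i) v + net.bias ℓ i)

/-- Floating-point activations `ẑ_ℓ(x)`. -/
def zhat (x : net.Vec 0) : (ℓ : ℕ) → net.Vec ℓ
  | 0 => x
  | ℓ + 1 => WithLp.toLp 2 fun i => net.act ℓ (net.fpPreact F σ ℓ (zhat x ℓ) i)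

/-- The floating-point network output `N̂(x)`. -/
def fpOutput (x : net.Vec 0) : net.Vec (net.hidden + 1) := net.zhat F σ x (net.hidden + 1)

/-- The floating-point margin `m̂_{j,i}(x) = N̂(x)_i - N̂(x)_j`. -/
def fpMargin (i j : Fin (net.dim (net.hidden + 1))) (x : net.Vec 0) : ℝ :=
  net.fpOutput F σ x i - net.fpOutput F σ x j

/-- The floating-point execution at `x` does not overflow: every product, partial sum,
preactivation and activation of every layer is a finite value of the format. -/
def NoOverflow (x : net.Vec 0) : Prop :=
  ∀ ℓ ≤ net.hidden, ∀ i,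
    (σ ℓ i).tree.DotFinite F (net.weight ℓ i) (net.zhat F σ x ℓ) ∧
    F.IsFinite (net.fpPreact F σ ℓ (net.zhat F σ x ℓ) i) ∧
    F.IsFinite (net.zhat F σ x (ℓ + 1) i)

end FloatingPoint

/-- The deterministic radii `r_ℓ(x, ε)`. -/
def radius (x : net.Vec 0) (ε : ℝ) : ℕ → ℝ
  | 0 => ‖x‖ + ε
  | ℓ + 1 => net.actLip ℓ * (specNorm (net.weight ℓ) * radius x ε ℓ + ‖net.bias ℓ‖)

variable (F : FloatFormat)

/-- Amplification factor `α` of the layer with index `ℓ`. -/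
def alpha (ℓ : ℕ) : ℝ :=
  net.actLip ℓ * (specNorm (net.weight ℓ) + F.kap (net.dim ℓ) * absSpecNorm (net.weight ℓ))

/-- Fresh-error term `β(r)` of the layer with index `ℓ`. -/
def beta (ℓ : ℕ) (r : ℝ) : ℝ :=
  net.actLip ℓ * (F.kap (net.dim ℓ) * absSpecNorm (net.weight ℓ) * r
    + F.unitRoundoff * ‖net.bias ℓ‖
    + (1 + F.unitRoundoff) * F.aDot (net.dim ℓ) * √(net.dim (ℓ + 1)))

/-- The worst-case deviation bounds `D_ℓ(x, ε)` for the format `F`. -/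
def devBound (x : net.Vec 0) (ε : ℝ) : ℕ → ℝ
  | 0 => 0
  | ℓ + 1 => net.alpha F ℓ * devBound x ε ℓ + net.beta F ℓ (net.radius x ε ℓ)

/-- `S = max_i ‖w_i‖₂ (r + D)` for the layer with index `ℓ`. -/
def rowSumBound (x : net.Vec 0) (ε : ℝ) (ℓ : ℕ) : ℝ :=
  (⨆ i, ‖(WithLp.toLp 2 (net.weight ℓ i) : EuclideanSpace ℝ (Fin (net.dim ℓ)))‖)
    * (net.radius x ε ℓ + net.devBound F x ε ℓ)

/-- `M = max_i ‖w_i‖_∞ (r + D)` for the layer with index `ℓ`. -/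
def rowMaxBound (x : net.Vec 0) (ε : ℝ) (ℓ : ℕ) : ℝ :=
  (⨆ i, ⨆ k, |net.weight ℓ i k|) * (net.radius x ε ℓ + net.devBound F x ε ℓ)

/-- The conditions for absence of overflow at the layer with index `ℓ`: finite floating-point
weights and biases, and the two scalar checks. -/
def OverflowCheck (x : net.Vec 0) (ε : ℝ) (ℓ : ℕ) : Prop :=
  (∀ i k, F.IsFinite (net.weight ℓ i k)) ∧ (∀ i, F.IsFinite (net.bias ℓ i)) ∧
  net.rowSumBound F x ε ℓ * (1 + F.gam (net.dim ℓ)) + F.aDotFwd (net.dim ℓ)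
      + (⨆ i, |net.bias ℓ i|) < F.maxFinite ∧
  net.rowMaxBound F x ε ℓ < F.maxFinite

/-- `α_L^{(j,i)} = ‖W_i - W_j‖₂ + κ ‖|W_i| + |W_j|‖₂` for rows of the output layer. -/
def pairAlpha (i j : Fin (net.dim (net.hidden + 1))) : ℝ :=
  ‖(WithLp.toLp 2 (fun k => net.weight net.hidden i k - net.weight net.hidden j k) :
      net.Vec net.hidden)‖
  + F.kap (net.dim net.hidden) *
    ‖(WithLp.toLp 2 (fun k => |net.weight net.hidden i k| + |net.weight net.hidden j k|) :
      net.Vec net.hidden)‖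

/-- `β_L^{(j,i)}(r)` for rows of the output layer. -/
def pairBeta (i j : Fin (net.dim (net.hidden + 1))) (r : ℝ) : ℝ :=
  F.kap (net.dim net.hidden) *
    ‖(WithLp.toLp 2 (fun k => |net.weight net.hidden i k| + |net.weight net.hidden j k|) :
      net.Vec net.hidden)‖ * r
  + F.unitRoundoff * (|net.bias net.hidden i| + |net.bias net.hidden j|)
  + 2 * (1 + F.unitRoundoff) * F.aDot (net.dim net.hidden)

/-- `E_ball^{(j,i)}`. -/
def errBall (x : net.Vec 0) (ε : ℝ) (i j : Fin (net.dim (net.hidden + 1))) : ℝ :=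
  net.pairAlpha F i j * net.devBound F x ε net.hidden
    + net.pairBeta F i j (net.radius x ε net.hidden)

/-- `D_{L-1}^hybrid(x) = ‖ẑ_{L-1}(x) - ẑ_{L-1}^hi(x)‖₂ + D_{L-1}^hi(x, 0)`, for the target
format `F` and the high-precision format `H`. -/
def hybridDev (H : FloatFormat) (σ τ : net.Schedule) (x : net.Vec 0) : ℝ :=
  ‖net.zhat F σ x net.hidden - net.zhat H τ x net.hidden‖ + net.devBound H x 0 net.hidden

/-- `E_ctr^{hybrid,(j,i)}`. -/
def errCtrHybrid (H : FloatFormat) (σ τ : net.Schedule) (x : net.Vec 0)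
    (i j : Fin (net.dim (net.hidden + 1))) : ℝ :=
  net.pairAlpha F i j * net.hybridDev F H σ τ x
    + net.pairBeta F i j (net.radius x 0 net.hidden)

end Network

end FPCert

end

/-!
A margin that is certified at the centre `x` in floating-point arithmetic is carried to a point `x'`
of the ball along the chain

  floating-point margin at `x` → exact margin at `x` → exact margin at `x'`
    → floating-point margin at `x'`.

The middle step costs `Lip j * ε`. The outer two are instances of
`Network.abs_fpMargin_sub_margin_le`, which bounds the margin error of the output layer by
`pairAlpha * d + pairBeta r` as soon as the exact last hidden activations have norm at most `r` and
the computed ones deviate from them by at most `d`. At `x'` the worst-case values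
`r = radius x ε` and `d = devBound x ε` are supplied by `Network.norm_z_le` and
`Network.norm_zhat_sub_z_le`. At `x` the deviation is measured against the high-precision run, whose
own deviation from real arithmetic is at most its `devBound`. Rounding errors are bounded here for
rounding without an upper exponent limit, so nothing has to be known about overflow of that run.

The deviation recursion rests on the error analysis of a dot product in an arbitrary order of
summation (`SumTree.abs_fpDot_sub_exactDot_le`). A product has a relative error `u` plus an underflow
error `absErr`; a sum of two floats has only a relative error, since a subnormal sum is exact, and
adding a zero to a float is exact. A sum of `n` terms thus costs at most `n` relative errors per
term. Passing from components to Euclidean norms gives the spectral norms of `W` and `|W|`.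

Overflow is excluded (`Network.noOverflow`) because rounding maps `[-maxFinite, maxFinite]` to
itself, the computed layer inputs have norm at most `radius + devBound`, and the partial sums are
bounded by the same error analysis.
-/

namespace FPCert

/-! ### Rounding to nearest -/

theorem abs_roundEven_sub_le (t : ℝ) : |(roundEven t : ℝ) - t| ≤ 1 / 2 := by
  have h := Int.floor_add_fract t
  have h1 := Int.fract_lt_one t
  have h0 := Int.fract_nonneg t
  unfold roundEven
  split_ifs <;> rw [abs_le] <;> push_cast <;> constructor <;> linarith

theorem roundEven_intCast (k : ℤ) : roundEven (k : ℝ) = k := by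
  simp [roundEven]

theorem abs_roundEven_le {t : ℝ} {n : ℤ} (h : |t| ≤ n) : |(roundEven t : ℝ)| ≤ n := by
  have h1 := abs_le.1 (abs_roundEven_sub_le t)
  have h2 := abs_le.1 h
  -- an integer below `n + 1` is at most `n`
  have h3 : roundEven t < n + 1 := by
    have : (roundEven t : ℝ) < n + 1 := by linarith
    exact_mod_cast this
  have h4 : -n - 1 < roundEven t := by
    have : (-n - 1 : ℝ) < roundEven t := by linarith
    exact_mod_cast this
  have h5 : |roundEven t| ≤ n := abs_le.2 ⟨by omega, by omega⟩
  exact_mod_cast h5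

namespace FloatFormat

variable (F : FloatFormat)

theorem spacing_pos (x : ℝ) : 0 < F.spacing x := by
  unfold spacing; positivity

theorem unitRoundoff_nonneg : 0 ≤ F.unitRoundoff := by
  unfold unitRoundoff; positivity

theorem absErr_nonneg : 0 ≤ F.absErr := by
  unfold absErr; positivity

theorem abs_lt_two_pow_mul_spacing (x : ℝ) : |x| < 2 ^ F.prec * F.spacing x := by
  have h := Int.lt_zpow_succ_log_self (b := 2) one_lt_two |x|
  refine h.trans_le ?_
  rw [spacing, ← zpow_natCast, ← zpow_add₀ two_ne_zero]
  push_cast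
  refine zpow_le_zpow_right₀ one_le_two ?_
  have := le_max_left (Int.log 2 |x|) F.emin
  omega

theorem abs_fl_sub_le_half_spacing (x : ℝ) : |F.fl x - x| ≤ F.spacing x / 2 := by
  have hs := F.spacing_pos x
  have : F.fl x - x = ((roundEven (x / F.spacing x) : ℝ) - x / F.spacing x) * F.spacing x := by
    rw [sub_mul, div_mul_cancel₀ _ hs.ne']; rfl
  rw [this, abs_mul, abs_of_pos hs]
  have := mul_le_mul_of_nonneg_right (abs_roundEven_sub_le (x / F.spacing x)) hs.le
  linarith

theorem half_spacing_of_log_lt {x : ℝ} (h : Int.log 2 |x| < F.emin) :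
    F.spacing x / 2 = F.absErr := by
  rw [spacing, absErr, max_eq_right h.le, zpow_add_one₀ two_ne_zero]
  ring

theorem half_spacing_le_of_le_log {x : ℝ} (hx : x ≠ 0) (h : F.emin ≤ Int.log 2 |x|) :
    F.spacing x / 2 ≤ F.unitRoundoff * |x| := by
  have hl := Int.zpow_log_le_self (b := 2) one_lt_two (abs_pos.2 hx)
  rw [spacing, unitRoundoff, max_eq_left h, zpow_add_one₀ two_ne_zero, sub_eq_add_neg,
    zpow_add₀ two_ne_zero]
  push_cast at hl
  have := mul_le_mul_of_nonneg_left hl (by positivity : (0 : ℝ) ≤ 2 ^ (-(F.prec : ℤ)))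
  linarith

theorem fl_zero : F.fl 0 = 0 := by
  have : roundEven 0 = 0 := by exact_mod_cast roundEven_intCast 0
  simp [fl, this]

/-- The standard model of rounding: a relative error for normal results plus an absolute error for
subnormal ones. -/
theorem abs_fl_sub_le (x : ℝ) : |F.fl x - x| ≤ F.unitRoundoff * |x| + F.absErr := by
  have hu := F.unitRoundoff_nonneg
  have ha := F.absErr_nonneg
  rcases eq_or_ne x 0 with rfl | hx
  · simpa [fl_zero] using ha
  refine (F.abs_fl_sub_le_half_spacing x).trans ?_
  rcases lt_or_ge (Int.log 2 |x|) F.emin with h | h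
  · rw [F.half_spacing_of_log_lt h]
    have := mul_nonneg hu (abs_nonneg x)
    linarith
  · have := F.half_spacing_le_of_le_log hx h
    linarith

theorem exists_two_zpow_eq_mul_spacing {x : ℝ} {e : ℤ} (hx : x ≠ 0)
    (hlt : |x| < (2 : ℝ) ^ ((F.prec : ℤ) + e)) (he : F.emin - (F.prec : ℤ) + 1 ≤ e) :
    ∃ k : ℕ, (2 : ℝ) ^ e = 2 ^ k * F.spacing x := by
  have hlog : Int.log 2 |x| < (F.prec : ℤ) + e :=
    (Int.lt_zpow_iff_log_lt one_lt_two (abs_pos.2 hx)).1 (by exact_mod_cast hlt)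
  refine ⟨(e - (max (Int.log 2 |x|) F.emin - (F.prec : ℤ) + 1)).toNat, ?_⟩
  rw [spacing, ← zpow_natCast, ← zpow_add₀ two_ne_zero, Int.toNat_of_nonneg]
  · congr 1; ring
  · rcases max_cases (Int.log 2 |x|) F.emin with h | h <;> omega

theorem fl_eq_self_of_eq_mul_spacing {x : ℝ} (k : ℤ) (h : x = k * F.spacing x) : F.fl x = x := by
  have : x / F.spacing x = k := by rw [div_eq_iff (F.spacing_pos x).ne']; exact h
  rw [fl, this, roundEven_intCast, ← h]

theorem fl_eq_self {v : ℝ} (hv : F.IsFloat v) : F.fl v = v := by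
  rcases eq_or_ne v 0 with rfl | h0
  · exact F.fl_zero
  obtain ⟨m, e, hm, he, hve⟩ := hv
  have hlt : |v| < (2 : ℝ) ^ ((F.prec : ℤ) + e) := by
    rw [hve, abs_mul, zpow_add₀ two_ne_zero, abs_of_pos (by positivity : (0 : ℝ) < 2 ^ e)]
    refine mul_lt_mul_of_pos_right ?_ (by positivity)
    exact_mod_cast hm
  obtain ⟨k, hk⟩ := F.exists_two_zpow_eq_mul_spacing h0 hlt he
  refine F.fl_eq_self_of_eq_mul_spacing (m * 2 ^ k) ?_
  push_cast
  rw [mul_assoc, ← hk, ← hve]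

theorem isFloat_zero : F.IsFloat 0 :=
  ⟨0, F.emin - (F.prec : ℤ) + 1, by simp, le_rfl, by simp⟩

theorem isFloat_fl (x : ℝ) : F.IsFloat (F.fl x) := by
  have hle : |x / F.spacing x| ≤ ((2 ^ F.prec : ℤ) : ℝ) := by
    rw [abs_div, abs_of_pos (F.spacing_pos x), div_le_iff₀ (F.spacing_pos x)]
    exact_mod_cast (F.abs_lt_two_pow_mul_spacing x).le
  have hr : |roundEven (x / F.spacing x)| ≤ 2 ^ F.prec := by
    exact_mod_cast abs_roundEven_le hle
  have hmax := le_max_right (Int.log 2 |x|) F.emin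
  rcases hr.lt_or_eq with h | h
  · exact ⟨_, _, h, by omega, rfl⟩
  · -- a significand rounded up to `2 ^ prec` is halved, and the exponent is raised by one
    obtain ⟨s, hs, hsr⟩ : ∃ s : ℤ, |s| = 1 ∧ roundEven (x / F.spacing x) = s * 2 ^ F.prec := by
      rcases abs_eq (by positivity : (0 : ℤ) ≤ 2 ^ F.prec) |>.1 h with h | h
      · exact ⟨1, by simp, by rw [h]; ring⟩
      · exact ⟨-1, by simp, by rw [h]; ring⟩
    obtain ⟨q, hq⟩ : ∃ q, F.prec = q + 1 := ⟨F.prec - 1, by have := F.two_le_prec; omega⟩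
    refine ⟨s * 2 ^ q, max (Int.log 2 |x|) F.emin - (F.prec : ℤ) + 1 + 1, ?_, by omega, ?_⟩
    · rw [abs_mul, hs, one_mul, abs_of_pos (by positivity), hq]
      exact pow_lt_pow_right₀ one_lt_two (by omega)
    · rw [fl, hsr, zpow_add_one₀ two_ne_zero, spacing]
      push_cast
      rw [show (2 : ℝ) ^ F.prec = 2 ^ q * 2 by rw [hq, pow_succ]]
      ring

/-- Every float is a multiple of the least positive one, so a sum of two floats is not affected by
underflow. -/
theorem IsFloat.exists_int {F : FloatFormat} {v : ℝ} (hv : F.IsFloat v) :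
    ∃ k : ℤ, v = k * (2 : ℝ) ^ (F.emin - (F.prec : ℤ) + 1) := by
  obtain ⟨m, e, -, he, rfl⟩ := hv
  refine ⟨m * 2 ^ (e - (F.emin - (F.prec : ℤ) + 1)).toNat, ?_⟩
  push_cast
  rw [mul_assoc, ← zpow_natCast, ← zpow_add₀ two_ne_zero, Int.toNat_of_nonneg (by omega)]
  congr 2
  ring

/-- An addition of floats has a purely relative error: a subnormal sum is exact. -/
theorem abs_fl_add_sub_le {s t : ℝ} (hs : F.IsFloat s) (ht : F.IsFloat t) :
    |F.fl (s + t) - (s + t)| ≤ F.unitRoundoff * |s + t| := by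
  rcases eq_or_ne (s + t) 0 with h0 | h0
  · simp [h0, fl_zero]
  rcases lt_or_ge (Int.log 2 |s + t|) F.emin with h | h
  · obtain ⟨a, ha⟩ := hs.exists_int
    obtain ⟨b, hb⟩ := ht.exists_int
    have : s + t = ((a + b : ℤ) : ℝ) * F.spacing (s + t) := by
      conv_lhs => rw [ha, hb]
      rw [spacing, max_eq_right h.le]
      push_cast
      ring
    rw [F.fl_eq_self_of_eq_mul_spacing _ this, sub_self, abs_zero]
    exact mul_nonneg F.unitRoundoff_nonneg (abs_nonneg _)
  · exact (F.abs_fl_sub_le_half_spacing _).trans (F.half_spacing_le_of_le_log h0 h)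

theorem maxFinite_eq :
    F.maxFinite = (2 ^ F.prec - 1) * (2 : ℝ) ^ ((F.emax : ℤ) - (F.prec : ℤ) + 1) := by
  have h2 : (2 : ℝ) ≠ 0 := two_ne_zero
  rw [maxFinite, zpow_add_one₀ h2, zpow_sub₀ h2, zpow_sub₀ h2]
  simp only [zpow_natCast, zpow_one]
  field_simp

/-- Rounding does not leave the finite range: the largest finite value is an integer multiple of
the spacing at every point of that range. -/
theorem abs_fl_le_maxFinite {x : ℝ} (hx : |x| ≤ F.maxFinite) : |F.fl x| ≤ F.maxFinite := by
  rcases eq_or_ne x 0 with rfl | h0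
  · simpa [fl_zero] using hx
  have hs := F.spacing_pos x
  have hlt : |x| < (2 : ℝ) ^ ((F.prec : ℤ) + ((F.emax : ℤ) - (F.prec : ℤ) + 1)) := by
    refine hx.trans_lt ?_
    rw [maxFinite_eq, zpow_add₀ two_ne_zero (F.prec : ℤ), zpow_natCast]
    exact mul_lt_mul_of_pos_right (by linarith) (by positivity)
  obtain ⟨k, hk⟩ := F.exists_two_zpow_eq_mul_spacing h0 hlt (by
    have := F.two_le_prec
    have := F.prec_le_emax
    unfold emin
    omega)
  have hN : F.maxFinite = (((2 ^ F.prec - 1) * 2 ^ k : ℤ) : ℝ) * F.spacing x := by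
    rw [maxFinite_eq, hk]
    push_cast
    ring
  rw [fl, abs_mul, abs_of_pos hs, hN]
  refine mul_le_mul_of_nonneg_right (abs_roundEven_le ?_) hs.le
  rw [abs_div, abs_of_pos hs, div_le_iff₀ hs, ← hN]
  exact hx

theorem isFinite_fl {x : ℝ} (hx : |x| ≤ F.maxFinite) : F.IsFinite (F.fl x) :=
  ⟨F.isFloat_fl x, F.abs_fl_le_maxFinite hx⟩

theorem IsFloat.mono {F H : FloatFormat} (hprec : F.prec ≤ H.prec) (hemax : F.emax ≤ H.emax)
    {v : ℝ} (hv : F.IsFloat v) : H.IsFloat v := by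
  obtain ⟨m, e, hm, he, rfl⟩ := hv
  refine ⟨m, e, hm.trans_le (pow_le_pow_right₀ one_le_two hprec), ?_, rfl⟩
  unfold emin at *
  omega

theorem one_add_gam (n : ℕ) : 1 + F.gam n = (1 + F.unitRoundoff) ^ n := by
  simp [gam]

theorem gam_nonneg (n : ℕ) : 0 ≤ F.gam n :=
  sub_nonneg.2 (one_le_pow₀ (by linarith [F.unitRoundoff_nonneg]))

theorem gam_mono {m n : ℕ} (h : m ≤ n) : F.gam m ≤ F.gam n :=
  sub_le_sub_right (pow_le_pow_right₀ (by linarith [F.unitRoundoff_nonneg]) h) 1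

theorem kap_nonneg (n : ℕ) : 0 ≤ F.kap n := by
  have := F.gam_nonneg n
  have := F.unitRoundoff_nonneg
  unfold kap
  positivity

theorem aDotFwd_nonneg (n : ℕ) : 0 ≤ F.aDotFwd n := by
  have := F.gam_nonneg (n - 1)
  have := F.absErr_nonneg
  unfold aDotFwd
  positivity

theorem aDotFwd_mono {m n : ℕ} (h : m ≤ n) : F.aDotFwd m ≤ F.aDotFwd n := by
  have := F.gam_nonneg (m - 1)
  have := F.gam_nonneg (n - 1)
  have := F.absErr_nonneg
  have := F.gam_mono (Nat.sub_le_sub_right h 1)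
  unfold aDotFwd
  gcongr

theorem aDotFwd_le_aDot (n : ℕ) : F.aDotFwd n ≤ F.aDot n := by
  have := F.absErr_nonneg
  have := F.gam_mono (Nat.sub_le n 1)
  unfold aDotFwd aDot
  gcongr

end FloatFormat

/-! ### Rounding errors of dot products -/

namespace SumTree

variable {n : ℕ} (F : FloatFormat) (a b : Fin n → ℝ)

theorem isFloat_fpDot (t : SumTree n) : F.IsFloat (t.fpDot F a b) := by
  cases t with
  | zero => exact F.isFloat_zero
  | leaf i => exact F.isFloat_fl _
  | node s t => exact F.isFloat_fl _

theorem fpDot_eq_zero_of_leaves_eq_nil (t : SumTree n) (h : t.leaves = []) :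
    t.fpDot F a b = 0 := by
  induction t with
  | zero => rfl
  | leaf i => simp [leaves] at h
  | node s t hs ht =>
    rw [leaves, List.append_eq_nil_iff] at h
    rw [fpDot, hs h.1, ht h.2, add_zero, F.fl_zero]

/-- The exact value of the sum that a tree evaluates. -/
def exactDot (t : SumTree n) : ℝ := (t.leaves.map fun i => a i * b i).sum

/-- The sum of the absolute values of the summands of a tree. -/
def absDot (t : SumTree n) : ℝ := (t.leaves.map fun i => |a i * b i|).sum

variable {a b} in
theorem absDot_nonneg (t : SumTree n) : 0 ≤ t.absDot a b := by
  refine List.sum_nonneg fun y hy => ?_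
  obtain ⟨i, -, rfl⟩ := List.mem_map.1 hy
  exact abs_nonneg _

theorem absDot_node (s t : SumTree n) :
    (node s t).absDot a b = s.absDot a b + t.absDot a b := by
  simp [absDot, leaves]

theorem exactDot_node (s t : SumTree n) :
    (node s t).exactDot a b = s.exactDot a b + t.exactDot a b := by
  simp [exactDot, leaves]

theorem abs_exactDot_le (t : SumTree n) : |t.exactDot a b| ≤ t.absDot a b := by
  induction t with
  | zero => simp [exactDot, absDot, leaves]
  | leaf i => simp [exactDot, absDot, leaves]
  | node s t hs ht =>
    rw [exactDot_node, absDot_node]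
    exact (abs_add_le _ _).trans (add_le_add hs ht)

/-- One further rounding of a sum with at least one summand is paid for by one further summand. -/
theorem roundoff_step {k l : ℕ} (hk : k ≠ 0) (hl : l ≠ 0) {A : ℝ} (hA : 0 ≤ A) :
    F.gam k * A + (1 + F.unitRoundoff) ^ (k - 1) * k * F.absErr
      + F.unitRoundoff * ((1 + F.gam k) * A + (1 + F.unitRoundoff) ^ (k - 1) * k * F.absErr)
      ≤ F.gam (k + l) * A + (1 + F.unitRoundoff) ^ (k + l - 1) * k * F.absErr := by
  have hu := F.unitRoundoff_nonneg
  have ha := F.absErr_nonneg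
  obtain ⟨k, rfl⟩ := Nat.exists_eq_succ_of_ne_zero hk
  have h1 : F.gam (k + 1 + 1) ≤ F.gam (k + 1 + l) := F.gam_mono (by omega)
  have h2 : (1 + F.unitRoundoff) ^ (k + 1) ≤ (1 + F.unitRoundoff) ^ (k + 1 + l - 1) :=
    pow_le_pow_right₀ (by linarith) (by omega)
  calc _ = F.gam (k + 1 + 1) * A + (1 + F.unitRoundoff) ^ (k + 1) * (k + 1 : ℕ) * F.absErr := by
        simp only [FloatFormat.gam, Nat.succ_eq_add_one, Nat.add_sub_cancel]
        ring
    _ ≤ _ := by simp only [Nat.succ_eq_add_one]; gcongr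

/-- The error of a floating-point dot product in any order of summation. A tree with `k ≥ 1`
summands has depth below `k` up to additions of zero, which are exact, so each product is rounded
at most `k` times and each underflow error at most `k - 1` times. -/
theorem abs_fpDot_sub_exactDot_le (t : SumTree n) :
    |t.fpDot F a b - t.exactDot a b|
      ≤ F.gam t.leaves.length * t.absDot a b + F.aDotFwd t.leaves.length := by
  have hu := F.unitRoundoff_nonneg
  induction t with
  | zero => simp [fpDot, exactDot, absDot, leaves, FloatFormat.aDotFwd]
  | leaf i =>
    have := F.abs_fl_sub_le (a i * b i)
    simpa [fpDot, exactDot, absDot, leaves, FloatFormat.aDotFwd, FloatFormat.gam] using this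
  | node s t hs ht =>
    have fs := s.isFloat_fpDot F a b
    have ft := t.isFloat_fpDot F a b
    rcases eq_or_ne s.leaves [] with h | hsn
    · simpa [fpDot, exactDot, absDot, leaves, h, s.fpDot_eq_zero_of_leaves_eq_nil F a b h,
        F.fl_eq_self ft] using ht
    rcases eq_or_ne t.leaves [] with h | htn
    · simpa [fpDot, exactDot, absDot, leaves, h, t.fpDot_eq_zero_of_leaves_eq_nil F a b h,
        F.fl_eq_self fs] using hs
    have hsl : s.leaves.length ≠ 0 := by simpa using hsn
    have htl : t.leaves.length ≠ 0 := by simpa using htn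
    have hfl := F.abs_fl_add_sub_le fs ft
    rw [exactDot_node, absDot_node, fpDot, leaves, List.length_append]
    simp only [FloatFormat.aDotFwd, FloatFormat.one_add_gam] at hs ht ⊢
    push_cast
    set k := s.leaves.length
    set l := t.leaves.length
    set p := s.fpDot F a b
    set q := t.fpDot F a b
    have hks := roundoff_step F hsl htl (s.absDot_nonneg (a := a) (b := b))
    have hkt := roundoff_step F htl hsl (t.absDot_nonneg (a := a) (b := b))
    rw [add_comm l k] at hkt
    have hp : |p| ≤ (1 + F.gam k) * s.absDot a b
        + (1 + F.unitRoundoff) ^ (k - 1) * k * F.absErr := by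
      have h1 := abs_exactDot_le a b s
      have h2 := abs_sub_abs_le_abs_sub p (s.exactDot a b)
      linarith
    have hq : |q| ≤ (1 + F.gam l) * t.absDot a b
        + (1 + F.unitRoundoff) ^ (l - 1) * l * F.absErr := by
      have h1 := abs_exactDot_le a b t
      have h2 := abs_sub_abs_le_abs_sub q (t.exactDot a b)
      linarith
    have hup := mul_le_mul_of_nonneg_left hp hu
    have huq := mul_le_mul_of_nonneg_left hq hu
    have hupq := mul_le_mul_of_nonneg_left (abs_add_le p q) hu
    have htri : |F.fl (p + q) - (s.exactDot a b + t.exactDot a b)|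
        ≤ |F.fl (p + q) - (p + q)| + (|p - s.exactDot a b| + |q - t.exactDot a b|) := by
      refine le_trans (le_of_eq ?_) ((abs_add_le _ _).trans
        (add_le_add_right (abs_add_le (p - s.exactDot a b) (q - t.exactDot a b)) _))
      congr 1
      ring
    linarith

theorem abs_fpDot_le (t : SumTree n) :
    |t.fpDot F a b|
      ≤ (1 + F.gam t.leaves.length) * t.absDot a b + F.aDotFwd t.leaves.length := by
  have h1 := abs_exactDot_le a b t
  have h2 := abs_sub_abs_le_abs_sub (t.fpDot F a b) (t.exactDot a b)
  have h3 := t.abs_fpDot_sub_exactDot_le F a b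
  linarith

variable {a b} in
theorem dotFinite_of_le (hmul : ∀ i, |a i * b i| ≤ F.maxFinite) (t : SumTree n)
    (hsum : (1 + F.gam t.leaves.length) * t.absDot a b + F.aDotFwd t.leaves.length
      ≤ F.maxFinite) :
    t.DotFinite F a b := by
  induction t with
  | zero => trivial
  | leaf i => exact F.isFinite_fl (hmul i)
  | node s t hs ht =>
    have As := s.absDot_nonneg (a := a) (b := b)
    have At := t.absDot_nonneg (a := a) (b := b)
    -- the bound of a tree dominates those of its subtrees
    have mono : ∀ {k : ℕ} {A : ℝ}, k ≤ (node s t).leaves.length → 0 ≤ A →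
        A ≤ (node s t).absDot a b → (1 + F.gam k) * A + F.aDotFwd k ≤ F.maxFinite := by
      intro k A hk hA hle
      refine le_trans ?_ hsum
      have h1 := F.gam_mono hk
      have h2 := F.aDotFwd_mono hk
      have h3 := F.gam_nonneg (node s t).leaves.length
      gcongr
    refine ⟨hs (mono (by simp [leaves]) As ?_), ht (mono (by simp [leaves]) At ?_),
      F.isFloat_fl _, ((node s t).abs_fpDot_le F a b).trans hsum⟩ <;>
    · rw [absDot_node]; linarith

end SumTree

namespace SumOrder

variable {n : ℕ} (o : SumOrder n) (a b : Fin n → ℝ)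

theorem length_leaves : o.tree.leaves.length = n := by
  simpa using o.perm.length_eq

theorem exactDot_eq : o.tree.exactDot a b = ∑ k, a k * b k := by
  rw [SumTree.exactDot, (o.perm.map _).sum_eq, Fin.sum_univ_def]

theorem absDot_eq : o.tree.absDot a b = ∑ k, |a k| * |b k| := by
  simp only [SumTree.absDot, (o.perm.map _).sum_eq, Fin.sum_univ_def, abs_mul]

/-- The error of a rounded dot product followed by the rounded addition of a bias. -/
theorem abs_fl_fpDot_add_sub_le (F : FloatFormat) {c : ℝ} (hc : F.IsFloat c) :
    |F.fl (o.tree.fpDot F a b + c) - (∑ k, a k * b k + c)|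
      ≤ F.kap n * ∑ k, |a k| * |b k| + F.unitRoundoff * |c|
        + (1 + F.unitRoundoff) * F.aDot n := by
  have hu := F.unitRoundoff_nonneg
  have h1 := F.abs_fl_add_sub_le (o.tree.isFloat_fpDot F a b) hc
  have h2 := o.tree.abs_fpDot_sub_exactDot_le F a b
  have h3 := o.tree.abs_fpDot_le F a b
  rw [o.length_leaves, o.absDot_eq] at h2 h3
  rw [o.exactDot_eq] at h2
  have h4 := F.aDotFwd_le_aDot n
  have h5 := mul_le_mul_of_nonneg_left (h3.trans (add_le_add_right h4 _)) hu
  have h6 := mul_le_mul_of_nonneg_left (abs_add_le (o.tree.fpDot F a b) c) hu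
  have h7 := abs_sub_le (F.fl (o.tree.fpDot F a b + c)) (o.tree.fpDot F a b + c)
    (∑ k, a k * b k + c)
  rw [add_sub_add_right_eq_sub] at h7
  unfold FloatFormat.kap
  linarith

end SumOrder

/-! ### Euclidean and spectral norms -/

theorem norm_le_of_abs_le {n : ℕ} {c : ℝ} (hc : 0 ≤ c) {v w : EuclideanSpace ℝ (Fin n)}
    (h : ∀ i, |v i| ≤ c * |w i|) : ‖v‖ ≤ c * ‖w‖ := by
  rw [← abs_of_nonneg hc, ← Real.norm_eq_abs, ← norm_smul, EuclideanSpace.norm_eq,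
    EuclideanSpace.norm_eq]
  refine Real.sqrt_le_sqrt (Finset.sum_le_sum fun i _ => pow_le_pow_left₀ (norm_nonneg _) ?_ 2)
  simpa [abs_of_nonneg hc, abs_mul] using h i

/-- The vector of absolute values of the components. -/
def absVec {n : ℕ} (v : EuclideanSpace ℝ (Fin n)) : EuclideanSpace ℝ (Fin n) :=
  WithLp.toLp 2 fun k => |v k|

theorem norm_absVec {n : ℕ} (v : EuclideanSpace ℝ (Fin n)) : ‖absVec v‖ = ‖v‖ := by
  simp [EuclideanSpace.norm_eq, absVec]

theorem abs_sum_mul_le {n : ℕ} (w v : EuclideanSpace ℝ (Fin n)) :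
    |∑ k, w k * v k| ≤ ‖w‖ * ‖v‖ := by
  have h := abs_real_inner_le_norm w v
  simpa [PiLp.inner_apply, mul_comm] using h

theorem sum_mul_abs_le {n : ℕ} (w v : EuclideanSpace ℝ (Fin n)) :
    ∑ k, w k * |v k| ≤ ‖w‖ * ‖v‖ := by
  have h := (le_abs_self _).trans (abs_sum_mul_le w (absVec v))
  rwa [norm_absVec] at h

theorem sum_abs_mul_abs_le {n : ℕ} (w v : EuclideanSpace ℝ (Fin n)) :
    ∑ k, |w k| * |v k| ≤ ‖w‖ * ‖v‖ := by
  have h := sum_mul_abs_le (absVec w) v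
  rwa [norm_absVec] at h

theorem abs_apply_le_norm {n : ℕ} (v : EuclideanSpace ℝ (Fin n)) (i : Fin n) : |v i| ≤ ‖v‖ :=
  PiLp.norm_apply_le v i

/-- The matrix-vector product on Euclidean spaces. -/
def matVec {m n : ℕ} (A : Matrix (Fin m) (Fin n) ℝ) (v : EuclideanSpace ℝ (Fin n)) :
    EuclideanSpace ℝ (Fin m) :=
  WithLp.toLp 2 fun i => ∑ k, A i k * v k

theorem norm_matVec_le {m n : ℕ} (A : Matrix (Fin m) (Fin n) ℝ)
    (v : EuclideanSpace ℝ (Fin n)) : ‖matVec A v‖ ≤ specNorm A * ‖v‖ :=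
  (LinearMap.toContinuousLinearMap (Matrix.toEuclideanLin A)).le_opNorm v

theorem specNorm_nonneg {m n : ℕ} (A : Matrix (Fin m) (Fin n) ℝ) : 0 ≤ specNorm A :=
  norm_nonneg _

theorem norm_matVec_abs_le {m n : ℕ} (A : Matrix (Fin m) (Fin n) ℝ)
    (v : EuclideanSpace ℝ (Fin n)) :
    ‖matVec (A.map fun a => |a|) (absVec v)‖ ≤ absSpecNorm A * ‖v‖ := by
  have h := norm_matVec_le (A.map fun a => |a|) (absVec v)
  rwa [norm_absVec] at h

theorem matVec_sub {m n : ℕ} (A : Matrix (Fin m) (Fin n) ℝ) (v w : EuclideanSpace ℝ (Fin n)) :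
    matVec A (v - w) = matVec A v - matVec A w := by
  ext i
  simp [matVec, mul_sub]

theorem norm_const {m : ℕ} {c : ℝ} (hc : 0 ≤ c) :
    ‖(WithLp.toLp 2 fun _ => c : EuclideanSpace ℝ (Fin m))‖ = c * √m := by
  simp [EuclideanSpace.norm_eq, Real.sqrt_sq hc, mul_comm]

theorem argMax_eq_of_lt {n : ℕ} [NeZero n] {y : EuclideanSpace ℝ (Fin n)} {i : Fin n}
    (h : ∀ j, j ≠ i → y j < y i) : argMax y = i := by
  have hmem := Finset.min'_mem (Finset.univ.filter fun i => ∀ j, y j ≤ y i)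
    ⟨i, Finset.mem_filter.2 ⟨Finset.mem_univ _, fun j =>
      (eq_or_ne j i).elim (fun e => e ▸ le_rfl) fun hne => (h j hne).le⟩⟩
  by_contra hne
  exact absurd ((Finset.mem_filter.1 hmem).2 i) (not_le.2 (h _ hne))

namespace Network

variable (net : Network)

/-! ### Deviation of the floating-point execution from real arithmetic -/

/-- Rows of the weight matrix as Euclidean vectors. -/
def row (ℓ : ℕ) (i : Fin (net.dim (ℓ + 1))) : net.Vec ℓ := WithLp.toLp 2 (net.weight ℓ i)

theorem norm_z_le
    (hact_zero : ∀ ℓ < net.hidden, net.act ℓ 0 = 0)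
    (hact_lip : ∀ ℓ < net.hidden, LipschitzWith (net.actLip ℓ) (net.act ℓ))
    {x x' : net.Vec 0} {ε : ℝ} (hx' : ‖x'‖ ≤ ‖x‖ + ε) :
    ∀ ℓ ≤ net.hidden, ‖net.z x' ℓ‖ ≤ net.radius x ε ℓ
  | 0, _ => hx'
  | ℓ + 1, hℓ => by
    have ih := norm_z_le hact_zero hact_lip hx' ℓ (by omega)
    have hact : ‖net.z x' (ℓ + 1)‖
        ≤ net.actLip ℓ * ‖matVec (net.weight ℓ) (net.z x' ℓ) + net.bias ℓ‖ := by
      refine norm_le_of_abs_le (net.actLip ℓ).2 fun i => ?_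
      have := (hact_lip ℓ hℓ).dist_le_mul
        ((∑ k, net.weight ℓ i k * net.z x' ℓ k) + net.bias ℓ i) 0
      rw [hact_zero ℓ hℓ, Real.dist_eq, Real.dist_eq, sub_zero, sub_zero] at this
      exact this
    refine hact.trans (mul_le_mul_of_nonneg_left ?_ (net.actLip ℓ).2)
    refine (norm_add_le _ _).trans (add_le_add_left ((norm_matVec_le _ _).trans ?_) _)
    exact mul_le_mul_of_nonneg_left ih (specNorm_nonneg _)

/-- One layer of the deviation recursion, before the activation: `v` is the computed and `w` the
exact input of the layer. -/
theorem norm_fpPreact_sub_le (F : FloatFormat) (σ : net.Schedule) (ℓ : ℕ)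
    (hb : ∀ i, F.IsFloat (net.bias ℓ i)) {v w : net.Vec ℓ} {r d : ℝ}
    (hw : ‖w‖ ≤ r) (hvw : ‖v - w‖ ≤ d) :
    ‖(WithLp.toLp 2 (net.fpPreact F σ ℓ v) : net.Vec (ℓ + 1))
        - (matVec (net.weight ℓ) w + net.bias ℓ)‖
      ≤ (specNorm (net.weight ℓ) + F.kap (net.dim ℓ) * absSpecNorm (net.weight ℓ)) * d
        + (F.kap (net.dim ℓ) * absSpecNorm (net.weight ℓ) * r + F.unitRoundoff * ‖net.bias ℓ‖
          + (1 + F.unitRoundoff) * F.aDot (net.dim ℓ) * √(net.dim (ℓ + 1))) := by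
  have hu := F.unitRoundoff_nonneg
  have hk := F.kap_nonneg (net.dim ℓ)
  have hd := (F.aDotFwd_nonneg _).trans (F.aDotFwd_le_aDot (net.dim ℓ))
  have hs := specNorm_nonneg (net.weight ℓ)
  have has : 0 ≤ absSpecNorm (net.weight ℓ) := specNorm_nonneg _
  have hc : 0 ≤ (1 + F.unitRoundoff) * F.aDot (net.dim ℓ) := by positivity
  set P : net.Vec (ℓ + 1) := WithLp.toLp 2 (net.fpPreact F σ ℓ v)
  set W := net.weight ℓ
  set A := matVec (W.map fun a => |a|) (absVec v)
  set C : net.Vec (ℓ + 1) := WithLp.toLp 2 fun _ => (1 + F.unitRoundoff) * F.aDot (net.dim ℓ)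
  have hround : ‖P - (matVec W v + net.bias ℓ)‖
      ≤ F.kap (net.dim ℓ) * ‖A‖ + F.unitRoundoff * ‖net.bias ℓ‖ + ‖C‖ := by
    have h1 : ‖P - (matVec W v + net.bias ℓ)‖
        ≤ 1 * ‖F.kap (net.dim ℓ) • A + F.unitRoundoff • absVec (net.bias ℓ) + C‖ := by
      refine norm_le_of_abs_le zero_le_one fun i => ?_
      rw [one_mul]
      exact ((σ ℓ i).abs_fl_fpDot_add_sub_le (W i) v F (hb i)).trans (le_abs_self _)
    rw [one_mul] at h1
    refine h1.trans ((norm_add₃_le).trans_eq ?_)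
    rw [norm_smul, norm_smul, norm_absVec, Real.norm_of_nonneg hk, Real.norm_of_nonneg hu]
  have hA := norm_matVec_abs_le W v
  have hC : ‖C‖ = (1 + F.unitRoundoff) * F.aDot (net.dim ℓ) * √(net.dim (ℓ + 1)) :=
    norm_const hc
  have hprop := norm_matVec_le W (v - w)
  have hv : ‖v‖ ≤ r + d := by
    have := norm_sub_norm_le v w
    linarith
  have hsplit : P - (matVec W w + net.bias ℓ)
      = (P - (matVec W v + net.bias ℓ)) + matVec W (v - w) := by
    rw [matVec_sub]; abel
  have h2 := mul_le_mul_of_nonneg_left (hA.trans (mul_le_mul_of_nonneg_left hv has)) hk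
  have h3 := mul_le_mul_of_nonneg_left hvw hs
  rw [hsplit]
  refine (norm_add_le _ _).trans ?_
  linarith

theorem norm_zhat_sub_z_le (F : FloatFormat) (σ : net.Schedule)
    (hact_zero : ∀ ℓ < net.hidden, net.act ℓ 0 = 0)
    (hact_lip : ∀ ℓ < net.hidden, LipschitzWith (net.actLip ℓ) (net.act ℓ))
    (hb : ∀ ℓ < net.hidden, ∀ i, F.IsFloat (net.bias ℓ i))
    {x x' : net.Vec 0} {ε : ℝ} (hx' : ‖x'‖ ≤ ‖x‖ + ε) :
    ∀ ℓ ≤ net.hidden, ‖net.zhat F σ x' ℓ - net.z x' ℓ‖ ≤ net.devBound F x ε ℓ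
  | 0, _ => by simp [zhat, z, devBound]
  | ℓ + 1, hℓ => by
    have ih := norm_zhat_sub_z_le F σ hact_zero hact_lip hb hx' ℓ (by omega)
    have hz := net.norm_z_le hact_zero hact_lip hx' ℓ (by omega)
    have hpre := net.norm_fpPreact_sub_le F σ ℓ (hb ℓ hℓ) hz ih
    have hact : ‖net.zhat F σ x' (ℓ + 1) - net.z x' (ℓ + 1)‖ ≤ net.actLip ℓ *
        ‖(WithLp.toLp 2 (net.fpPreact F σ ℓ (net.zhat F σ x' ℓ)) : net.Vec (ℓ + 1))
          - (matVec (net.weight ℓ) (net.z x' ℓ) + net.bias ℓ)‖ := by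
      refine norm_le_of_abs_le (net.actLip ℓ).2 fun i => ?_
      exact (hact_lip ℓ hℓ).dist_le_mul _ _
    refine (hact.trans (mul_le_mul_of_nonneg_left hpre (net.actLip ℓ).2)).trans_eq ?_
    rw [devBound, alpha, beta]
    ring

/-! ### Error of the output margins -/

/-- The margin error is bounded by working with the difference of two output rows. The network
enters only through a bound `r` on the exact and `d` on the deviation of the last hidden
activations. -/
theorem abs_fpMargin_sub_margin_le (F : FloatFormat) (σ : net.Schedule)
    (hact_out : net.act net.hidden = id) (hb : ∀ i, F.IsFloat (net.bias net.hidden i))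
    {x : net.Vec 0} {r d : ℝ} (hr : ‖net.z x net.hidden‖ ≤ r)
    (hd : ‖net.zhat F σ x net.hidden - net.z x net.hidden‖ ≤ d)
    (i j : Fin (net.dim (net.hidden + 1))) :
    |net.fpMargin F σ i j x - net.margin i j x|
      ≤ net.pairAlpha F i j * d + net.pairBeta F i j r := by
  have hk := F.kap_nonneg (net.dim net.hidden)
  set v := net.zhat F σ x net.hidden
  set w := net.z x net.hidden
  set W := net.weight net.hidden with hW
  have hi := (σ net.hidden i).abs_fl_fpDot_add_sub_le (W i) v F (hb i)
  have hj := (σ net.hidden j).abs_fl_fpDot_add_sub_le (W j) v F (hb j)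
  have hfi : net.fpOutput F σ x i = F.fl ((σ net.hidden i).tree.fpDot F (W i) v
      + net.bias net.hidden i) := by
    simp only [fpOutput, zhat, hact_out]; rfl
  have hfj : net.fpOutput F σ x j = F.fl ((σ net.hidden j).tree.fpDot F (W j) v
      + net.bias net.hidden j) := by
    simp only [fpOutput, zhat, hact_out]; rfl
  have hoi : net.output x i = ∑ k, W i k * w k + net.bias net.hidden i := by
    simp only [output, z, hact_out]; rfl
  have hoj : net.output x j = ∑ k, W j k * w k + net.bias net.hidden j := by
    simp only [output, z, hact_out]; rfl
  rw [← hfi] at hi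
  rw [← hfj] at hj
  have hprop := abs_sum_mul_le (WithLp.toLp 2 fun k => W i k - W j k : net.Vec net.hidden) (v - w)
  have hsum : ∑ k, (W i k - W j k) * (v k - w k)
      = (∑ k, W i k * v k - ∑ k, W j k * v k) - (∑ k, W i k * w k - ∑ k, W j k * w k) := by
    simp only [← Finset.sum_sub_distrib]
    exact Finset.sum_congr rfl fun k _ => by ring
  simp only [PiLp.sub_apply] at hprop
  rw [hsum] at hprop
  have habs := sum_mul_abs_le (WithLp.toLp 2 fun k => |W i k| + |W j k| : net.Vec net.hidden) v
  simp only [add_mul, Finset.sum_add_distrib] at habs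
  have hv : ‖v‖ ≤ r + d := by
    have := norm_sub_norm_le v w
    linarith
  have h1 := mul_le_mul_of_nonneg_left
    (habs.trans (mul_le_mul_of_nonneg_left hv (norm_nonneg _))) hk
  have h2 := mul_le_mul_of_nonneg_left hd
    (norm_nonneg (WithLp.toLp 2 fun k => W i k - W j k : net.Vec net.hidden))
  rw [fpMargin, margin, hoi, hoj, pairAlpha, pairBeta, ← hW]
  rw [abs_le] at hi hj hprop ⊢
  constructor <;> linarith

/-! ### Absence of overflow -/

theorem noOverflow (F : FloatFormat) (σ : net.Schedule)
    (hact_zero : ∀ ℓ < net.hidden, net.act ℓ 0 = 0)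
    (hact_lip : ∀ ℓ < net.hidden, LipschitzWith (net.actLip ℓ) (net.act ℓ))
    (hact_exact : ∀ ℓ < net.hidden, F.ActExact (net.act ℓ))
    (hact_out : net.act net.hidden = id)
    {x x' : net.Vec 0} {ε : ℝ} (hover : ∀ ℓ ≤ net.hidden, net.OverflowCheck F x ε ℓ)
    (hx' : ‖x'‖ ≤ ‖x‖ + ε) : net.NoOverflow F σ x' := by
  intro ℓ hℓ i
  obtain ⟨-, hb, hS, hM⟩ := hover ℓ hℓ
  set v := net.zhat F σ x' ℓ
  have hR : ‖v‖ ≤ net.radius x ε ℓ + net.devBound F x ε ℓ := by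
    have h1 := net.norm_z_le hact_zero hact_lip hx' ℓ hℓ
    have h2 := net.norm_zhat_sub_z_le F σ hact_zero hact_lip
      (fun k hk i => ((hover k hk.le).2.1 i).1) hx' ℓ hℓ
    have h3 := norm_sub_norm_le v (net.z x' ℓ)
    linarith
  have hR0 := (norm_nonneg v).trans hR
  have hg := F.gam_nonneg (net.dim ℓ)
  have hbi : |net.bias ℓ i| ≤ ⨆ i, |net.bias ℓ i| :=
    le_ciSup (f := fun i => |net.bias ℓ i|) (Set.finite_range _).bddAbove i
  -- the bound `S` controls all partial sums of the row
  have hrow : ∑ k, |net.weight ℓ i k| * |v k| ≤ net.rowSumBound F x ε ℓ :=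
    (sum_abs_mul_abs_le (net.row ℓ i) v).trans (mul_le_mul
      (le_ciSup (f := fun i => ‖net.row ℓ i‖) (Set.finite_range _).bddAbove i) hR
      (norm_nonneg _) (Real.iSup_nonneg fun _ => norm_nonneg _))
  -- the bound `M` controls all products of the row
  have hmul : ∀ k, |net.weight ℓ i k * v k| ≤ F.maxFinite := by
    intro k
    refine le_trans ?_ hM.le
    rw [abs_mul]
    refine mul_le_mul ?_ ((abs_apply_le_norm v k).trans hR) (abs_nonneg _)
      (Real.iSup_nonneg fun _ => Real.iSup_nonneg fun _ => abs_nonneg _)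
    exact (le_ciSup (f := fun k => |net.weight ℓ i k|) (Set.finite_range _).bddAbove k).trans
      (le_ciSup (f := fun i => ⨆ k, |net.weight ℓ i k|) (Set.finite_range _).bddAbove i)
  have hbound := mul_le_mul_of_nonneg_left hrow (by linarith : 0 ≤ 1 + F.gam (net.dim ℓ))
  have hdot := (σ ℓ i).tree.abs_fpDot_le F (net.weight ℓ i) v
  have hpre : F.IsFinite (net.fpPreact F σ ℓ v i) := by
    refine F.isFinite_fl ((abs_add_le _ _).trans ?_)
    rw [SumOrder.length_leaves, SumOrder.absDot_eq] at hdot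
    linarith
  refine ⟨SumTree.dotFinite_of_le F hmul _ ?_, hpre, ?_⟩
  · rw [SumOrder.length_leaves, SumOrder.absDot_eq]
    have := abs_nonneg (net.bias ℓ i)
    linarith
  · change F.IsFinite (net.act ℓ (net.fpPreact F σ ℓ v i))
    rcases hℓ.lt_or_eq with h | rfl
    · exact hact_exact ℓ h _ hpre
    · rw [hact_out]
      exact hpre

end Network

end FPCert

theorem mainTheorem6
    (net : FPCert.Network) [NeZero (net.dim (net.hidden + 1))]
    -- target format and high-precision format, each with its own order of summation
    (F H : FPCert.FloatFormat) (hprec : F.prec ≤ H.prec) (hemax : F.emax ≤ H.emax)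
    (σ τ : net.Schedule)
    -- standing assumptions on the activations; the output layer has the identity activation
    (hact_zero : ∀ ℓ < net.hidden, net.act ℓ 0 = 0)
    (hact_lip : ∀ ℓ < net.hidden, LipschitzWith (net.actLip ℓ) (net.act ℓ))
    (hact_exact : ∀ ℓ < net.hidden, F.ActExact (net.act ℓ) ∧ H.ActExact (net.act ℓ))
    (hact_out : net.act net.hidden = id)
    (x : net.Vec 0) (ε : ℝ) (hε : 0 < ε)
    (istar : Fin (net.dim (net.hidden + 1))) (histar : istar = FPCert.argMax (net.output x))
    -- (i) the overflow conditions over the ball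
    (hover : ∀ ℓ ≤ net.hidden, net.OverflowCheck F x ε ℓ)
    -- (ii) margin Lipschitz constants of the real-arithmetic network
    (Lip : Fin (net.dim (net.hidden + 1)) → ℝ)
    (hLip_nonneg : ∀ j, j ≠ istar → 0 ≤ Lip j)
    (hLip : ∀ j, j ≠ istar → ∀ x₁ x₂ : net.Vec 0,
      |net.margin istar j x₁ - net.margin istar j x₂| ≤ Lip j * ‖x₁ - x₂‖)
    -- (iii) the hybrid certification check
    (hcert : ∀ j, j ≠ istar →
      0 < net.fpMargin F σ istar j x - Lip j * ε
        - (net.errCtrHybrid F H σ τ x istar j + net.errBall F x ε istar j)) :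
    (∀ x' : net.Vec 0, ‖x - x'‖ ≤ ε →
      net.NoOverflow F σ x' ∧
      (∀ j, j ≠ istar → 0 < net.fpMargin F σ istar j x') ∧
      FPCert.argMax (net.fpOutput F σ x') = istar) ∧
    FPCert.IsRobust (net.fpOutput F σ) x ε := by
  have hbF : ∀ ℓ ≤ net.hidden, ∀ i, F.IsFloat (net.bias ℓ i) :=
    fun ℓ hℓ i => ((hover ℓ hℓ).2.1 i).1
  have hbF' : ∀ ℓ < net.hidden, ∀ i, F.IsFloat (net.bias ℓ i) := fun ℓ hℓ => hbF ℓ hℓ.le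
  have hbH : ∀ ℓ < net.hidden, ∀ i, H.IsFloat (net.bias ℓ i) :=
    fun ℓ hℓ i => (hbF' ℓ hℓ i).mono hprec hemax
  have hx0 : ‖x‖ ≤ ‖x‖ + 0 := (add_zero _).ge
  -- the deviation at the centre, by way of the high-precision run
  have hctr : ‖net.zhat F σ x net.hidden - net.z x net.hidden‖ ≤ net.hybridDev F H σ τ x :=
    (norm_sub_le_norm_sub_add_norm_sub _ (net.zhat H τ x net.hidden) _).trans
      (add_le_add_right (net.norm_zhat_sub_z_le H τ hact_zero hact_lip hbH hx0 _ le_rfl) _)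
  have key : ∀ x' : net.Vec 0, ‖x - x'‖ ≤ ε →
      net.NoOverflow F σ x' ∧
      (∀ j, j ≠ istar → 0 < net.fpMargin F σ istar j x') ∧
      FPCert.argMax (net.fpOutput F σ x') = istar := by
    intro x' hxx'
    have hx' : ‖x'‖ ≤ ‖x‖ + ε := by
      have := norm_sub_norm_le x' x
      rw [norm_sub_rev] at this
      linarith
    have hmargin : ∀ j, j ≠ istar → 0 < net.fpMargin F σ istar j x' := by
      intro j hj
      have h1 := net.abs_fpMargin_sub_margin_le F σ hact_out (hbF _ le_rfl)
        (net.norm_z_le hact_zero hact_lip hx0 _ le_rfl) hctr istar j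
      have h2 := net.abs_fpMargin_sub_margin_le F σ hact_out (hbF _ le_rfl)
        (net.norm_z_le hact_zero hact_lip hx' _ le_rfl)
        (net.norm_zhat_sub_z_le F σ hact_zero hact_lip hbF' hx' _ le_rfl) istar j
      have h3 := (hLip j hj x x').trans (mul_le_mul_of_nonneg_left hxx' (hLip_nonneg j hj))
      have h4 := hcert j hj
      rw [FPCert.Network.errCtrHybrid, FPCert.Network.errBall] at h4
      rw [abs_le] at h1 h2 h3
      linarith
    exact ⟨net.noOverflow F σ hact_zero hact_lip (fun ℓ hℓ => (hact_exact ℓ hℓ).1) hact_out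
      hover hx', hmargin, FPCert.argMax_eq_of_lt fun j hj => sub_pos.1 (hmargin j hj)⟩
  refine ⟨key, fun x' hx' => ?_⟩
  rw [(key x' hx').2.2, (key x (by simpa using hε.le)).2.2]
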